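/- Let $n,k,\ell,d$ be non-negative integers and let $A$ be an $\ell\times k$ matrix whose entries are homogeneous polynomials of the same degree $d$ in $\mathbb{C}[\partial_1,\dots,\partial_n]$. For $y\in\mathbb{P}^{n-1}$ let $A(y)$ be the complex $\ell\times k$ matrix, well defined up to scale, obtained by replacing each $\partial_i$ by $y_i$, and regard $\ker A(y)$ as a linear subspace of $\mathbb{P}^{k-1}$; all projective spaces are over $\mathbb{C}$. Let $\mathrm{Gr}(m,n)$ be the Grassmannian of $m$-dimensional linear subspaces of $\mathbb{C}^n$, i.e. of $(m-1)$-dimensional linear subspaces of $\mathbb{P}^{n-1}$. Define $$\mathcal{W}^r_A=\bigcup_{\pi\in\mathrm{Gr}(n-r,n)}\ \bigcap_{y\in\pi}\ker A(y)\quad(0\le r\le n-1),\qquad \mathcal{O}^r_A=\bigcap_{\sigma\in\mathrm{Gr}(r,n)}\ \bigcup_{y\in\sigma}\ker A(y)\quad(1\le r\le n),$$ where $y$ runs over points of $\mathbb{P}^{n-1}$. For $1\le m\le n$ put $$\mathcal{I}_{A,m}=\{(y,z,\pi)\in\mathbb{P}^{n-1}\times\mathbb{P}^{k-1}\times\mathrm{Gr}(m,n)\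 :\ A(y)z=0\ \text{and}\ y\in\pi\}.$$ Then: 1. For every $r\in\{0,\dots,n-1\}$, the set $\mathcal{W}^r_A$ is Zariski closed in $\mathbb{P}^{k-1}$, i.e. it is the set of common zeros of finitely many homogeneous polynomials in $k$ variables. 2. For every $r\in\{1,\dots,n\}$, the set $\mathcal{O}^r_A$ is Zariski closed in $\mathbb{P}^{k-1}$, in the same sense. 3. For every $m\in\{1,\dots,n\}$, $\mathcal{I}_{A,m}$ is closed in $\mathbb{P}^{n-1}\times\mathbb{P}^{k-1}\times\mathrm{Gr}(m,n)$: it is cut out by finitely many polynomials in the coordinates $y$, the coordinates $z$ and the Plücker coordinates $p$ of $\pi$ that are homogeneous in each of these three groups of variables. 4. The sets $\mathcal{W}^r_A$ and $\mathcal{O}^r_A$ arise from these incidence varieties by quantifier elimination: $$\mathcal{W}^r_A=\{z:\ \exists\,\pi\in\mathrm{Gr}(n-r,n)\ \ \forall\, y\in\pi:\ (y,z,\pi)\in\mathcal{I}_{A,n-r}\}\quad(0\le r\le n-1),$$ $$\mathcal{O}^r_A=\{z:\ \forall\,\sigma\in\mathrm{Gr}(r,n)\ \ \exists\, y\in\mathbb{P}^{n-1}:\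 (y,z,\sigma)\in\mathcal{I}_{A,r}\}\quad(1\le r\le n).$$ -/

import Mathlib

namespace WaveVar

/-- `ProjPt n` is the complex projective space of dimension `n - 1`, with homogeneous coordinates
indexed by `Fin n`. -/
abbrev ProjPt (n : ℕ) : Type := Projectivization ℂ (Fin n → ℂ)

/-- The Grassmannian of `m`-dimensional linear subspaces of `ℂ ^ n`. -/
abbrev Gr (m n : ℕ) : Type := {π : Submodule ℂ (Fin n → ℂ) // Module.finrank ℂ π = m}

/-- The projective linear subspace defined by a linear subspace of `ℂ ^ n`: the set of its
lines. -/
def points {n : ℕ} (π : Submodule ℂ (Fin n → ℂ)) : Set (ProjPt n) :=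
  {y | y.submodule ≤ π}

theorem mk_mem_points {n : ℕ} (π : Submodule ℂ (Fin n → ℂ)) (v : Fin n → ℂ) (hv : v ≠ 0) :
    Projectivization.mk ℂ v hv ∈ points π ↔ v ∈ π := by
  simp [points, Submodule.span_singleton_le_iff_mem]

/-- A matrix with entries in `ℂ[∂₁, …, ∂ₙ]`. -/
abbrev PolyMatrix (l k n : ℕ) : Type := Matrix (Fin l) (Fin k) (MvPolynomial (Fin n) ℂ)

/-- The complex matrix `A(v)`, obtained by replacing each variable by a coordinate of `v`. -/
noncomputable def evalAt {l k n : ℕ} (A : PolyMatrix l k n) (v : Fin n → ℂ) : Matrix (Fin l) (Fin k) ℂ :=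
  A.map (MvPolynomial.eval v)

/-- `ker A(y)`, as a linear subspace of projective space. If all entries of `A` are homogeneous of
the same degree, it does not depend on the homogeneous coordinates chosen for `y`;
see `mk_mem_kerAt_mk`. -/
noncomputable def kerAt {l k n : ℕ} (A : PolyMatrix l k n) (y : ProjPt n) : Set (ProjPt k) :=
  points (LinearMap.ker (Matrix.toLin' (evalAt A y.rep)))

theorem evalAt_smul {l k n d : ℕ} (A : PolyMatrix l k n) (hA : ∀ i j, (A i j).IsHomogeneous d)
    (c : ℂ) (v : Fin n → ℂ) : evalAt A (c • v) = c ^ d • evalAt A v := by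
  ext i j
  simp only [evalAt, Matrix.map_apply, Matrix.smul_apply, smul_eq_mul]
  rw [MvPolynomial.eval_eq', MvPolynomial.eval_eq', Finset.mul_sum]
  refine Finset.sum_congr rfl fun e he => ?_
  have hd : ∑ t, e t = d := by
    have := hA i j (MvPolynomial.mem_support_iff.mp he)
    rw [Finsupp.weight_apply, Finsupp.sum_fintype _ _ (by simp)] at this
    simpa using this
  simp only [Pi.smul_apply, smul_eq_mul, mul_pow, Finset.prod_mul_distrib]
  rw [Finset.prod_pow_eq_pow_sum, hd]
  ring

theorem mk_mem_kerAt_mk {l k n d : ℕ} (A : PolyMatrix l k n)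
    (hA : ∀ i j, (A i j).IsHomogeneous d) (v : Fin n → ℂ) (hv : v ≠ 0)
    (w : Fin k → ℂ) (hw : w ≠ 0) :
    Projectivization.mk ℂ w hw ∈ kerAt A (Projectivization.mk ℂ v hv) ↔
      (evalAt A v).mulVec w = 0 := by
  obtain ⟨a, ha⟩ := Projectivization.exists_smul_eq_mk_rep ℂ v hv
  rw [kerAt, mk_mem_points, ← ha, Units.smul_def, evalAt_smul A hA, LinearMap.mem_ker,
    Matrix.toLin'_apply, Matrix.smul_mulVec, smul_eq_zero]
  simp

/-- The level `r` wave variety. -/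
def waveVariety {l k n : ℕ} (A : PolyMatrix l k n) (r : ℕ) : Set (ProjPt k) :=
  ⋃ π : Gr (n - r) n, ⋂ y ∈ points π.1, kerAt A y

/-- The level `r` obstruction variety. -/
def obstructionVariety {l k n : ℕ} (A : PolyMatrix l k n) (r : ℕ) : Set (ProjPt k) :=
  ⋂ σ : Gr r n, ⋃ y ∈ points σ.1, kerAt A y

/-- The incidence variety of all `(y, z, π)` with `A(y) z = 0` and `y ∈ π`, where `π` runs over
the Grassmannian of `m`-dimensional linear subspaces. -/
def incidence {l k n : ℕ} (A : PolyMatrix l k n) (m : ℕ) : Set (ProjPt n × ProjPt k × Gr m n) :=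
  {x | x.2.1 ∈ kerAt A x.1 ∧ x.1 ∈ points x.2.2.1}

/-- The set `X` is a (Zariski closed, possibly reducible or empty) projective variety: the set of
common zeros of finitely many homogeneous polynomials. -/
def IsProjectiveVariety {k : ℕ} (X : Set (ProjPt k)) : Prop :=
  ∃ F : Set (MvPolynomial (Fin k) ℂ), F.Finite ∧ (∀ f ∈ F, ∃ e, f.IsHomogeneous e) ∧
    ∀ (v : Fin k → ℂ) (hv : v ≠ 0),
      Projectivization.mk ℂ v hv ∈ X ↔ ∀ f ∈ F, MvPolynomial.eval v f = 0

/-- `p` is a vector of Plücker coordinates of `π`: the vector of maximal minors of a matrix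
whose rows are a basis of `π`. The index sets `I` are written as increasing maps. -/
def IsPlucker {m n : ℕ} (π : Gr m n) (p : (Fin m ↪o Fin n) → ℂ) : Prop :=
  ∃ S : Matrix (Fin m) (Fin n) ℂ, Submodule.span ℂ (Set.range S) = π.1 ∧
    ∀ I : Fin m ↪o Fin n, p I = (S.submatrix id I).det

/-- The weights that define the tridegree of a polynomial in three groups of variables. -/
def triWeight {α β γ : Type} : α ⊕ β ⊕ γ → ℕ × ℕ × ℕ :=
  Sum.elim (fun _ => (1, 0, 0)) (Sum.elim (fun _ => (0, 1, 0)) (fun _ => (0, 0, 1)))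

/-- `X` is a closed subvariety of the product of two projective spaces and a Grassmannian in
its Plücker embedding: it is the set of common zeros of finitely many polynomials in the coordinates
`(y, z, p)` that are homogeneous in each of the three groups of variables. -/
def IsTriprojectiveVariety {n k m : ℕ} (X : Set (ProjPt n × ProjPt k × Gr m n)) : Prop :=
  ∃ F : Set (MvPolynomial (Fin n ⊕ Fin k ⊕ (Fin m ↪o Fin n)) ℂ), F.Finite ∧
    (∀ f ∈ F, ∃ e : ℕ × ℕ × ℕ, f.IsWeightedHomogeneous triWeight e) ∧
    ∀ (v : Fin n → ℂ) (hv : v ≠ 0) (w : Fin k → ℂ) (hw : w ≠ 0) (π : Gr m n)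
      (p : (Fin m ↪o Fin n) → ℂ), IsPlucker π p →
      ((Projectivization.mk ℂ v hv, Projectivization.mk ℂ w hw, π) ∈ X ↔
        ∀ f ∈ F, MvPolynomial.eval (Sum.elim v (Sum.elim w p)) f = 0)

end WaveVar

/-!
Regard a nonzero alternating form `ω` of degree `m` on `ℂ ^ n` as an alternating tensor. Its
contractions span a subspace supporting `ω`, and contracting along a tuple `u` with `ω u ≠ 0`
already produces an `m`-dimensional space of vectors. Conversely, an `m`-dimensional subspace
contains all contractions of the determinant form that represents it. So for `m = n - r` the wave
variety consists of the `z` for which some nonzero `ω`, decomposable or not, satisfies `A(w) z = 0`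
for all contractions `w` of `ω`. No Plücker relation is needed, and `ω` ranges over a projective
space.

A point `ω` of a projective space is eliminated from homogeneous equations by the projective
Nullstellensatz: there is no common zero if and only if the equations generate a power of the
irrelevant ideal, which says that some Macaulay matrix has a nonzero maximal minor. The equations
are linear in `z`, so these minors are homogeneous polynomials in `z`. The obstruction
variety is the intersection over `σ` of the projections obtained in the same way by eliminating
`y ∈ σ`; finitely many equations suffice because the polynomial ring is Noetherian.

For the incidence variety, `y ∈ π` means that the matrix formed by `y` and a basis of `π` has
dependent rows, that is, vanishing maximal minors; their expansions along the row `y` are bilinear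
in `y` and the Plücker coordinates of `π`.
-/

open MvPolynomial

namespace WaveVar

section Minors

variable {K : Type*} [Field K]

theorem exists_embedding_linearIndependent_of_span_range_eq_top {μ ρ : Type*} [Finite μ]
    {v : ρ → μ → K} (hv : Submodule.span K (Set.range v) = ⊤) :
    ∃ φ : μ ↪ ρ, LinearIndependent K (v ∘ φ) := by
  obtain ⟨κ, a, ha, hspan, hli⟩ := exists_linearIndependent' K v
  let b := Module.Basis.mk hli (by rw [hspan, hv])
  let e : μ ≃ κ := (Pi.basisFun K μ).indexEquiv b
  exact ⟨e.toEmbedding.trans ⟨a, ha⟩, hli.comp e e.injective⟩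

theorem exists_det_submatrix_ne_zero_of_span_row_eq_top {μ ρ : Type*} [Fintype μ] [DecidableEq μ]
    {M : Matrix ρ μ K} (hM : Submodule.span K (Set.range M.row) = ⊤) :
    ∃ φ : μ → ρ, (M.submatrix φ id).det ≠ 0 := by
  obtain ⟨φ, hφ⟩ := exists_embedding_linearIndependent_of_span_range_eq_top hM
  have hrow : LinearIndependent K (M.submatrix φ id).row := hφ
  exact ⟨φ, ((Matrix.isUnit_iff_isUnit_det _).mp
    (Matrix.linearIndependent_rows_iff_isUnit.mp hrow)).ne_zero⟩

variable {ν : Type*} [Finite ν] [LinearOrder ν] {m : ℕ}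

theorem linearIndependent_row_iff_exists_det_submatrix_ne_zero {S : Matrix (Fin m) ν K} :
    LinearIndependent K S.row ↔ ∃ J : Fin m ↪o ν, (S.submatrix id J).det ≠ 0 := by
  cases nonempty_fintype ν
  constructor
  · intro hS
    have hspan : Submodule.span K (Set.range S.col) = ⊤ := Submodule.eq_top_of_finrank_eq (by
      rw [← Matrix.rank_eq_finrank_span_cols, hS.rank_matrix, Module.finrank_fintype_fun_eq_card])
    obtain ⟨φ, hφ⟩ := exists_embedding_linearIndependent_of_span_range_eq_top hspan
    let J : Fin m ↪o ν := (Finset.univ.map φ).orderEmbOfFin (by simp)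
    have hJ : Set.range J = Set.range φ := by simp [J]
    have hcol : LinearIndependent K (S.submatrix id J).col := by
      rw [← linearIndepOn_range_iff φ.injective, ← hJ, linearIndepOn_range_iff J.injective] at hφ
      exact hφ
    exact ⟨J, ((Matrix.isUnit_iff_isUnit_det _).mp
      (Matrix.linearIndependent_cols_iff_isUnit.mp hcol)).ne_zero⟩
  · rintro ⟨J, hJ⟩
    have hrow : LinearIndependent K (S.submatrix id J).row :=
      Matrix.linearIndependent_rows_of_det_ne_zero hJ
    exact LinearIndependent.of_comp (LinearMap.funLeft K K J) hrow

theorem mem_span_row_iff_forall_det_cons_eq_zero {S : Matrix (Fin m) ν K}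
    (hS : LinearIndependent K S.row) (v : ν → K) :
    v ∈ Submodule.span K (Set.range S.row) ↔ ∀ J : Fin (m + 1) ↪o ν,
      ((Matrix.of (Fin.cons v S.row : Fin (m + 1) → ν → K)).submatrix id J).det = 0 := by
  have hcons : LinearIndependent K (Fin.cons v S.row : Fin (m + 1) → ν → K) ↔
      v ∉ Submodule.span K (Set.range S.row) :=
    linearIndependent_finCons.trans (and_iff_right hS)
  rw [← not_iff_not, ← hcons, not_forall]
  exact linearIndependent_row_iff_exists_det_submatrix_ne_zero
    (S := Matrix.of (Fin.cons v S.row : Fin (m + 1) → ν → K))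

end Minors

section MacaulayMatrix

variable {R K τ ι : Type*} [CommRing R] [Field K]

theorem exists_pow_idealOfVars_le_span [Finite τ] [IsAlgClosed K] {g : ι → MvPolynomial τ K}
    (hg : ∀ t : τ → K, (∀ i, eval t (g i) = 0) → t = 0) :
    ∃ N, idealOfVars τ K ^ N ≤ Ideal.span (Set.range g) := by
  have hrad : idealOfVars τ K ≤ (Ideal.span (Set.range g)).radical := by
    rw [← vanishingIdeal_zeroLocus_eq_radical (K := K), zeroLocus_span, idealOfVars, Ideal.span_le]
    rintro _ ⟨s, rfl⟩
    rw [SetLike.mem_coe, mem_vanishingIdeal_iff]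
    intro t ht
    have ht0 : t = 0 := hg t fun i => by simpa [aeval_eq_eval] using ht (g i) ⟨i, rfl⟩
    simp [ht0]
  obtain ⟨N, hN⟩ := Ideal.exists_radical_pow_le_of_fg (Ideal.span (Set.range g))
    (IsNoetherian.noetherian _)
  exact ⟨N, (Ideal.pow_right_mono hrad N).trans hN⟩

open scoped Pointwise in
theorem span_monomial_mul_eq_restrictScalars_span (g : ι → MvPolynomial τ R) :
    Submodule.span R (Set.range fun x : (τ →₀ ℕ) × ι => monomial x.1 1 * g x.2) =
      (Ideal.span (Set.range g)).restrictScalars R := by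
  have hmonomial : Submodule.span R (Set.range fun a : τ →₀ ℕ => (monomial a 1 : MvPolynomial τ R))
      = ⊤ := by
    simpa [coe_basisMonomials] using (basisMonomials τ R).span_eq
  rw [Ideal.span, ← Submodule.span_smul_of_span_eq_top hmonomial, Set.range_smul_range]
  rfl

variable [Fintype τ] [DecidableEq τ]

/-- The exponents of the monomials of degree `N` in the variables indexed by `τ`. -/
abbrev monomialExponents (τ : Type*) [Fintype τ] [DecidableEq τ] (N : ℕ) : Finset (τ →₀ ℕ) :=
  Finset.finsuppAntidiag Finset.univ N

theorem mem_monomialExponents {N : ℕ} {e : τ →₀ ℕ} :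
    e ∈ monomialExponents τ N ↔ e.degree = N := by
  simp [Finset.mem_finsuppAntidiag, Finsupp.degree_eq_sum]

/-- The Macaulay matrix in degree `N` of a family of polynomials: its rows list the coefficients in
degree `N` of all products of a monomial with a member of the family. -/
noncomputable def macaulayMatrix (g : ι → MvPolynomial τ R) (N : ℕ) :
    Matrix ((τ →₀ ℕ) × ι) (monomialExponents τ N) R :=
  Matrix.of fun x e => coeff e.1 (monomial x.1 1 * g x.2)

theorem map_macaulayMatrix {S : Type*} [CommRing S] (φ : R →+* S) (g : ι → MvPolynomial τ R)
    (N : ℕ) :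
    (macaulayMatrix g N).map φ = macaulayMatrix (fun i => map φ (g i)) N := by
  ext x e
  simp [macaulayMatrix, ← coeff_map]

theorem macaulayMatrix_mulVec_monomials (g : ι → MvPolynomial τ R) (N : ℕ) (t : τ → R)
    (x : (τ →₀ ℕ) × ι) :
    (macaulayMatrix g N).mulVec (fun e => ∏ i, t i ^ e.1 i) x =
      eval t (homogeneousComponent N (monomial x.1 1 * g x.2)) := by
  set p := monomial x.1 1 * g x.2
  calc ∑ e : monomialExponents τ N, coeff e.1 p * ∏ i, t i ^ e.1 i
    _ = ∑ e ∈ monomialExponents τ N, coeff e p * ∏ i, t i ^ e i :=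
      Finset.sum_coe_sort _ fun e => coeff e p * ∏ i, t i ^ e i
    _ = ∑ e ∈ p.support with e.degree = N, coeff e p * ∏ i, t i ^ e i := by
      refine (Finset.sum_subset (fun e he => ?_) fun e he he' => ?_).symm
      · exact mem_monomialExponents.mpr (Finset.mem_filter.mp he).2
      · rw [Finset.mem_filter, not_and_or, notMem_support_iff] at he'
        rw [he'.resolve_right (not_not_intro (mem_monomialExponents.mp he)), zero_mul]
    _ = eval t (homogeneousComponent N p) := by
      simp [homogeneousComponent_apply, eval_monomial, Finsupp.prod_fintype]

theorem span_row_macaulayMatrix_eq_top {g : ι → MvPolynomial τ R} {N : ℕ}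
    (hN : idealOfVars τ R ^ N ≤ Ideal.span (Set.range g)) :
    Submodule.span R (Set.range (macaulayMatrix g N).row) = ⊤ := by
  let coeffs : MvPolynomial τ R →ₗ[R] monomialExponents τ N → R :=
    LinearMap.pi fun e => lcoeff R e.1
  have hrow : (macaulayMatrix g N).row = coeffs ∘ fun x => monomial x.1 1 * g x.2 := rfl
  rw [hrow, Set.range_comp, ← Submodule.map_span, span_monomial_mul_eq_restrictScalars_span,
    eq_top_iff, ← (Pi.basisFun R _).span_eq, Submodule.span_le]
  rintro _ ⟨e, rfl⟩
  refine ⟨monomial e.1 1, hN ?_, ?_⟩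
  · rw [pow_idealOfVars_eq_span]
    exact Ideal.subset_span ⟨e.1, mem_monomialExponents.mp e.2, rfl⟩
  · ext e'
    simp only [coeffs, LinearMap.pi_apply, lcoeff_apply, coeff_monomial, Pi.basisFun_apply,
      Pi.single_apply]
    exact if_congr (by rw [Subtype.ext_iff, eq_comm]) rfl rfl

theorem exists_ne_zero_forall_eval_eq_zero_iff_det_macaulayMatrix [IsAlgClosed K]
    {g : ι → MvPolynomial τ K} {d : ι → ℕ} (hg : ∀ i, (g i).IsHomogeneous (d i)) :
    (∃ t : τ → K, t ≠ 0 ∧ ∀ i, eval t (g i) = 0) ↔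
      ∀ (N : ℕ) (φ : monomialExponents τ N → (τ →₀ ℕ) × ι),
        ((macaulayMatrix g N).submatrix φ id).det = 0 := by
  constructor
  · rintro ⟨t, ht, hzero⟩ N φ
    obtain ⟨s, hs⟩ := Function.ne_iff.mp ht
    rw [← Matrix.exists_mulVec_eq_zero_iff]
    refine ⟨fun e => ∏ i, t i ^ e.1 i, Function.ne_iff.mpr
      ⟨⟨Finsupp.single s N, by simp⟩, ?_⟩, funext fun e => ?_⟩
    · have hprod : ∏ i, t i ^ Finsupp.single s N i = t s ^ N :=
        (Finset.prod_eq_single s (by simp +contextual) (by simp)).trans (by simp)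
      simpa [hprod] using fun h : t s = 0 => absurd h hs
    · have hhom : (monomial (φ e).1 (1 : K) * g (φ e).2).IsHomogeneous
          ((φ e).1.degree + d (φ e).2) := (isHomogeneous_monomial _ rfl).mul (hg _)
      refine (macaulayMatrix_mulVec_monomials g N t (φ e)).trans ?_
      rw [homogeneousComponent_of_mem hhom]
      split_ifs <;> simp [hzero]
  · contrapose!
    intro hne
    obtain ⟨N, hN⟩ := exists_pow_idealOfVars_le_span (g := g) fun t ht => by
      by_contra ht0
      obtain ⟨i, hi⟩ := hne t ht0
      exact hi (ht i)
    exact ⟨N, exists_det_submatrix_ne_zero_of_span_row_eq_top (span_row_macaulayMatrix_eq_top hN)⟩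

end MacaulayMatrix

section Elimination

variable {K τ ι κ : Type*} [Field K] [IsAlgClosed K] [Finite τ]

theorem isHomogeneous_det {R μ : Type*} [CommRing R] [Fintype μ] [DecidableEq μ]
    {M : Matrix μ μ (MvPolynomial κ R)} {c : μ → ℕ} (hM : ∀ i j, (M i j).IsHomogeneous (c i)) :
    M.det.IsHomogeneous (∑ i, c i) := by
  rw [← Matrix.det_transpose, Matrix.det_apply]
  refine IsHomogeneous.sum _ _ _ fun σ _ => ?_
  have hprod : (∏ i, M i (σ i)).IsHomogeneous (∑ i, c i) :=
    IsHomogeneous.prod _ _ _ fun i _ => hM i (σ i)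
  exact (homogeneousSubmodule κ R _).smul_of_tower_mem (Equiv.Perm.sign σ) hprod

theorem exists_isHomogeneous_eliminants {f : ι → MvPolynomial τ (MvPolynomial κ K)} {c d : ι → ℕ}
    (hf : ∀ i, (f i).IsHomogeneous (d i)) (hcoeff : ∀ i e, (coeff e (f i)).IsHomogeneous (c i)) :
    ∃ G : Set (MvPolynomial κ K), (∀ p ∈ G, ∃ e, p.IsHomogeneous e) ∧ ∀ z : κ → K,
      (∃ t : τ → K, t ≠ 0 ∧ ∀ i, eval t (map (eval z) (f i)) = 0) ↔ ∀ p ∈ G, eval z p = 0 := by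
  classical
  cases nonempty_fintype τ
  let minor (x : Σ N, monomialExponents τ N → (τ →₀ ℕ) × ι) : MvPolynomial κ K :=
    ((macaulayMatrix f x.1).submatrix x.2 id).det
  refine ⟨Set.range minor, ?_, fun z => ?_⟩
  · rintro _ ⟨⟨N, φ⟩, rfl⟩
    refine ⟨_, isHomogeneous_det (c := fun e => c (φ e).2) fun e e' => ?_⟩
    simp only [Matrix.submatrix_apply, macaulayMatrix, Matrix.of_apply, coeff_monomial_mul',
      one_mul]
    split_ifs
    exacts [hcoeff _ _, isHomogeneous_zero _ _ _]
  · have heval (x) : eval z (minor x) =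
        ((macaulayMatrix (fun i => map (eval z) (f i)) x.1).submatrix x.2 id).det := by
      rw [RingHom.map_det, ← map_macaulayMatrix]
      rfl
    simp only [Set.forall_mem_range, heval, Sigma.forall,
      exists_ne_zero_forall_eval_eq_zero_iff_det_macaulayMatrix fun i => (hf i).map (eval z)]

theorem exists_isHomogeneous_eliminants_mulVec [Fintype κ]
    {B : Matrix ι κ (MvPolynomial τ K)} {d : ι → ℕ} (hB : ∀ i j, (B i j).IsHomogeneous (d i)) :
    ∃ G : Set (MvPolynomial κ K), (∀ p ∈ G, ∃ e, p.IsHomogeneous e) ∧ ∀ z : κ → K,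
      (∃ t : τ → K, t ≠ 0 ∧ (B.map (eval t)).mulVec z = 0) ↔ ∀ p ∈ G, eval z p = 0 := by
  let f (i : ι) : MvPolynomial τ (MvPolynomial κ K) := ∑ j, C (X j) * map C (B i j)
  have hf (i) : (f i).IsHomogeneous (d i) :=
    IsHomogeneous.sum _ _ _ fun j _ => ((hB i j).map C).C_mul _
  have hcoeff (i e) : (coeff e (f i)).IsHomogeneous 1 := by
    simp only [f, coeff_sum, coeff_C_mul, coeff_map]
    exact IsHomogeneous.sum _ _ _ fun j _ => (isHomogeneous_X K j).mul (isHomogeneous_C κ _)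
  have heval (t z i) : eval t (map (eval z) (f i)) = (B.map (eval t)).mulVec z i := by
    have hC : (eval z).comp C = RingHom.id K := RingHom.ext fun a => eval_C a
    simp [f, map_map, hC, Matrix.mulVec, dotProduct, mul_comm]
  simpa only [heval, _root_.funext_iff, Pi.zero_apply] using
    exists_isHomogeneous_eliminants hf hcoeff

end Elimination

section AlternatingForms

instance finite_alternatingMap {K κ M N : Type*} [Field K] [Finite κ] [AddCommGroup M] [Module K M]
    [Module.Finite K M] [AddCommGroup N] [Module K N] [Module.Finite K N] :
    Module.Finite K (M [⋀^κ]→ₗ[K] N) :=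
  Module.Finite.of_injective (AlternatingMap.toMultilinearMapLM (S := K))
    AlternatingMap.coe_multilinearMap_injective

variable {K κ ν : Type*} [Field K] [Fintype κ] [DecidableEq κ] [DecidableEq ν]

/-- The vector `contraction u ω c` represents the linear form `∑ a, c a * ω (…, ·, …)` obtained by
inserting `x` in place of the `a`-th vector of `u`; see `contraction_dotProduct`. Regarding `ω` as
an alternating tensor, these vectors lie in every subspace that supports it. -/
noncomputable def contraction (u : κ → ν → K) :
    ((ν → K) [⋀^κ]→ₗ[K] K) →ₗ[K] (κ → K) →ₗ[K] ν → K :=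
  LinearMap.mk₂ K (fun ω c j => ∑ a, c a * ω (Function.update u a (Pi.single j 1)))
    (fun ω ω' c => by ext j; simp [mul_add, Finset.sum_add_distrib])
    (fun r ω c => by ext j; simp [Finset.mul_sum, mul_left_comm])
    (fun ω c c' => by ext j; simp [add_mul, Finset.sum_add_distrib])
    (fun r ω c => by ext j; simp [Finset.mul_sum, mul_assoc])

theorem contraction_dotProduct [Fintype ν] (u : κ → ν → K) (ω : (ν → K) [⋀^κ]→ₗ[K] K) (c : κ → K)
    (x : ν → K) :
    contraction u ω c ⬝ᵥ x = ∑ a, c a * ω (Function.update u a x) := by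
  have hω (a : κ) : ω (Function.update u a x) =
      ∑ j, ω (Function.update u a (Pi.single j 1)) * x j := by
    refine ((ω.toMultilinearMap.toLinearMap u a).pi_apply_eq_sum_univ x).trans ?_
    refine Finset.sum_congr rfl fun j _ => ?_
    rw [smul_eq_mul, mul_comm, MultilinearMap.toLinearMap_apply, AlternatingMap.coe_multilinearMap]
    congr 3
    exact funext fun j' => (if_congr eq_comm rfl rfl).trans (Pi.single_apply j 1 j').symm
  simp only [contraction, LinearMap.mk₂_apply, dotProduct, hω, Finset.sum_mul, Finset.mul_sum,
    mul_assoc]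
  exact Finset.sum_comm

theorem contraction_dotProduct_self [Fintype ν] (u : κ → ν → K) (ω : (ν → K) [⋀^κ]→ₗ[K] K)
    (c : κ → K) (b : κ) : contraction u ω c ⬝ᵥ u b = c b * ω u := by
  rw [contraction_dotProduct, Finset.sum_eq_single b]
  · rw [Function.update_eq_self]
  · intro a _ hab
    rw [ω.map_update_self u hab, mul_zero]
  · simp

theorem exists_finrank_range_contraction_eq_card [Finite ν] {ω : (ν → K) [⋀^κ]→ₗ[K] K}
    (hω : ω ≠ 0) :
    ∃ u : κ → ν → K, Module.finrank K (LinearMap.range (contraction u ω)) = Fintype.card κ := by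
  cases nonempty_fintype ν
  obtain ⟨u, hu⟩ : ∃ u, ω u ≠ 0 := by
    contrapose! hω
    exact AlternatingMap.ext hω
  have hinj : Function.Injective (contraction u ω) := by
    rw [← LinearMap.ker_eq_bot, LinearMap.ker_eq_bot']
    intro c hc
    funext b
    have hb := contraction_dotProduct_self u ω c b
    rw [hc, zero_dotProduct] at hb
    exact (mul_eq_zero.mp hb.symm).resolve_right hu
  exact ⟨u, by rw [LinearMap.finrank_range_of_inj hinj, Module.finrank_fintype_fun_eq_card]⟩

theorem contraction_compLinearMap_mulVecLin [Fintype ν] (S : Matrix κ ν K)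
    (ω : (κ → K) [⋀^κ]→ₗ[K] K) (u : κ → ν → K) (c : κ → K) :
    contraction u (ω.compLinearMap S.mulVecLin) c =
      Matrix.vecMul (contraction (fun a => S.mulVec (u a)) ω c) S := by
  refine dotProduct_eq _ _ fun x => ?_
  rw [← Matrix.dotProduct_mulVec, contraction_dotProduct, contraction_dotProduct]
  exact Finset.sum_congr rfl fun a _ =>
    congrArg (c a * ω ·) (Function.comp_update S.mulVecLin u a x)

theorem exists_ne_zero_forall_contraction_mem [Finite ν] {π : Submodule K (ν → K)}
    (hπ : Module.finrank K π = Fintype.card κ) :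
    ∃ ω : (ν → K) [⋀^κ]→ₗ[K] K, ω ≠ 0 ∧ ∀ (u : κ → ν → K) (c : κ → K), contraction u ω c ∈ π := by
  cases nonempty_fintype ν
  let b : Module.Basis κ K π := .ofEquivFun
    (LinearEquiv.ofFinrankEq π (κ → K) (by rw [hπ, Module.finrank_fintype_fun_eq_card]))
  let S : Matrix κ ν K := Matrix.of fun a => (b a : ν → K)
  have hS : LinearIndependent K S.row :=
    b.linearIndependent.map' π.subtype (Submodule.ker_subtype _)
  have hsurj : Function.Surjective S.mulVecLin := by
    rw [← LinearMap.range_eq_top]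
    apply Submodule.eq_top_of_finrank_eq
    rw [Module.finrank_fintype_fun_eq_card, ← hS.rank_matrix, Matrix.rank]
  refine ⟨Matrix.detRowAlternating.compLinearMap S.mulVecLin, fun h => ?_, fun u c => ?_⟩
  · choose u hu using hsurj
    have hdet : Matrix.detRowAlternating (1 : Matrix κ κ K) = 0 := by
      simpa only [AlternatingMap.compLinearMap_apply, hu, AlternatingMap.zero_apply] using
        DFunLike.congr_fun h fun a => u ((1 : Matrix κ κ K) a)
    exact one_ne_zero (Matrix.det_one.symm.trans hdet)
  · rw [contraction_compLinearMap_mulVecLin, Matrix.vecMul_eq_sum]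
    exact Submodule.sum_mem _ fun a _ => Submodule.smul_mem _ _ (b a).2

end AlternatingForms

section ProjectiveVarieties

variable {k : ℕ}

theorem IsProjectiveVariety.of_isHomogeneous {X : Set (ProjPt k)} {G : Set (MvPolynomial (Fin k) ℂ)}
    (hG : ∀ g ∈ G, ∃ e, g.IsHomogeneous e)
    (hX : ∀ (v : Fin k → ℂ) (hv : v ≠ 0),
      Projectivization.mk ℂ v hv ∈ X ↔ ∀ g ∈ G, eval v g = 0) : IsProjectiveVariety X := by
  obtain ⟨F, hFG, hF⟩ := (Submodule.fg_span_iff_fg_span_finset_subset G).mp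
    (IsNoetherian.noetherian (Ideal.span G))
  refine ⟨F, F.finite_toSet, fun f hf => hG f (hFG hf), fun v hv => (hX v hv).trans
    ⟨fun h f hf => h f (hFG hf), fun h g hg => ?_⟩⟩
  have hker : Ideal.span F ≤ RingHom.ker (eval v) := Ideal.span_le.mpr h
  exact hker (hF.le (Ideal.subset_span hg))

theorem IsProjectiveVariety.iInter {ι : Sort*} {X : ι → Set (ProjPt k)}
    (hX : ∀ i, IsProjectiveVariety (X i)) : IsProjectiveVariety (⋂ i, X i) := by
  choose F _ hF hXF using hX
  refine .of_isHomogeneous (G := ⋃ i, F i) (fun g hg => ?_) fun v hv => ?_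
  · obtain ⟨i, hi⟩ := Set.mem_iUnion.mp hg
    exact hF i g hi
  · simp only [Set.mem_iInter, Set.mem_iUnion, hXF]
    exact ⟨fun h f ⟨i, hi⟩ => h i f hi, fun h i f hi => h f ⟨i, hi⟩⟩

theorem IsProjectiveVariety.of_exists_ne_zero_forall_evalAt_mulVec_eq_zero {l n d : ℕ}
    {A : PolyMatrix l k n} (hA : ∀ i j, (A i j).IsHomogeneous d) {E ι : Type*} [AddCommGroup E]
    [Module ℂ E] [FiniteDimensional ℂ E] (L : ι → E →ₗ[ℂ] Fin n → ℂ) {X : Set (ProjPt k)}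
    (hX : ∀ (v : Fin k → ℂ) (hv : v ≠ 0), Projectivization.mk ℂ v hv ∈ X ↔
      ∃ t : E, t ≠ 0 ∧ ∀ i, (evalAt A (L i t)).mulVec v = 0) : IsProjectiveVariety X := by
  let b := Module.finBasis ℂ E
  let form (i : ι) := (L i).toMvPolynomial b (Pi.basisFun ℂ (Fin n))
  let B : Matrix (ι × Fin l) (Fin k) (MvPolynomial (Fin (Module.finrank ℂ E)) ℂ) :=
    Matrix.of fun x j => bind₁ (form x.1) (A x.2 j)
  have hB (x j) : (B x j).IsHomogeneous d := by
    have h := (hA x.2 j).aeval (form x.1)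
      ((L x.1).toMvPolynomial_isHomogeneous b (Pi.basisFun ℂ (Fin n)))
    rwa [one_mul] at h
  have heval (t : E) : B.map (eval (b.repr t)) = Matrix.of fun x => evalAt A (L x.1 t) x.2 := by
    ext x j
    have hform (s) : eval (b.repr t) (form x.1 s) = L x.1 t s := by
      simp [form, LinearMap.toMvPolynomial_eval_eq_apply]
    simpa only [aeval_eq_eval, hform] using! aeval_bind₁ (b.repr t) (form x.1) (A x.2 j)
  obtain ⟨G, hG, hGX⟩ := exists_isHomogeneous_eliminants_mulVec hB
  refine .of_isHomogeneous hG fun v hv => ?_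
  rw [hX, ← hGX, b.equivFun.surjective.exists]
  refine exists_congr fun t => and_congr b.equivFun.map_ne_zero_iff.symm ?_
  change _ ↔ (B.map (eval (b.repr t))).mulVec v = 0
  rw [heval]
  simp only [_root_.funext_iff, Prod.forall]
  rfl

end ProjectiveVarieties

section WaveAndObstruction

variable {l k n d : ℕ} {A : PolyMatrix l k n}

theorem mk_mem_iUnion_kerAt_iff (hA : ∀ i j, (A i j).IsHomogeneous d)
    (σ : Submodule ℂ (Fin n → ℂ)) (v : Fin k → ℂ) (hv : v ≠ 0) :
    Projectivization.mk ℂ v hv ∈ ⋃ y ∈ points σ, kerAt A y ↔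
      ∃ w ∈ σ, w ≠ 0 ∧ (evalAt A w).mulVec v = 0 := by
  simp only [Set.mem_iUnion, exists_prop]
  constructor
  · rintro ⟨y, hy, hvy⟩
    induction y using Projectivization.ind with
    | h w hw => exact ⟨w, (mk_mem_points _ _ _).mp hy, hw, (mk_mem_kerAt_mk A hA _ _ _ _).mp hvy⟩
  · rintro ⟨w, hwσ, hw, hwv⟩
    exact ⟨_, (mk_mem_points _ _ hw).mpr hwσ, (mk_mem_kerAt_mk A hA _ _ _ _).mpr hwv⟩

theorem mk_mem_iInter_kerAt_iff (hA : ∀ i j, (A i j).IsHomogeneous d)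
    (π : Submodule ℂ (Fin n → ℂ)) (v : Fin k → ℂ) (hv : v ≠ 0) :
    Projectivization.mk ℂ v hv ∈ ⋂ y ∈ points π, kerAt A y ↔
      ∀ w ∈ π, w ≠ 0 → (evalAt A w).mulVec v = 0 := by
  simp only [Set.mem_iInter]
  constructor
  · intro h w hwπ hw
    exact (mk_mem_kerAt_mk A hA _ hw _ hv).mp (h _ ((mk_mem_points _ _ hw).mpr hwπ))
  · intro h y hy
    induction y using Projectivization.ind with
    | h w hw => exact (mk_mem_kerAt_mk A hA _ _ _ _).mpr (h w ((mk_mem_points _ _ _).mp hy) hw)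

theorem evalAt_zero_mulVec_eq_zero (hA : ∀ i j, (A i j).IsHomogeneous d) {w : Fin n → ℂ}
    {v : Fin k → ℂ} (hwv : (evalAt A w).mulVec v = 0) : (evalAt A 0).mulVec v = 0 := by
  rw [← zero_smul ℂ w, evalAt_smul A hA, Matrix.smul_mulVec, hwv, smul_zero]

theorem isProjectiveVariety_obstructionVariety (hA : ∀ i j, (A i j).IsHomogeneous d) (r : ℕ) :
    IsProjectiveVariety (obstructionVariety A r) := by
  refine .iInter fun σ => .of_exists_ne_zero_forall_evalAt_mulVec_eq_zero hA
    (fun _ : Unit => σ.1.subtype) fun v hv => ?_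
  rw [mk_mem_iUnion_kerAt_iff hA]
  simp [and_left_comm]

theorem isProjectiveVariety_waveVariety (hA : ∀ i j, (A i j).IsHomogeneous d) {r : ℕ}
    (hr : r < n) : IsProjectiveVariety (waveVariety A r) := by
  refine .of_exists_ne_zero_forall_evalAt_mulVec_eq_zero hA
    (fun x : (Fin (n - r) → Fin n → ℂ) × (Fin (n - r) → ℂ) => (contraction x.1).flip x.2)
    fun v hv => ?_
  simp only [waveVariety, Set.mem_iUnion (s := fun π : Gr (n - r) n => ⋂ y ∈ points π.1, kerAt A y),
    mk_mem_iInter_kerAt_iff hA, LinearMap.flip_apply, Prod.forall]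
  constructor
  · rintro ⟨π, hπ⟩
    have hπ0 : π.1 ≠ ⊥ := Submodule.one_le_finrank_iff.mp (by rw [π.2]; omega)
    obtain ⟨w₀, hw₀π, hw₀⟩ := π.1.exists_mem_ne_zero_of_ne_bot hπ0
    obtain ⟨ω, hω, hωπ⟩ := exists_ne_zero_forall_contraction_mem (κ := Fin (n - r))
      (π.2.trans (Fintype.card_fin _).symm)
    refine ⟨ω, hω, fun u c => ?_⟩
    obtain hw | hw := eq_or_ne (contraction u ω c) 0
    · rw [hw]
      exact evalAt_zero_mulVec_eq_zero hA (hπ w₀ hw₀π hw₀)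
    · exact hπ _ (hωπ u c) hw
  · rintro ⟨ω, hω, hωv⟩
    obtain ⟨u, hu⟩ := exists_finrank_range_contraction_eq_card hω
    refine ⟨⟨LinearMap.range (contraction u ω), hu.trans (Fintype.card_fin _)⟩, ?_⟩
    rintro _ ⟨c, rfl⟩ -
    exact hωv u c

theorem waveVariety_eq_setOf_exists_forall_mem_incidence (A : PolyMatrix l k n) (r : ℕ) :
    waveVariety A r =
      {z | ∃ π : Gr (n - r) n, ∀ y ∈ points π.1, (y, z, π) ∈ incidence A (n - r)} := by
  ext z
  refine Set.mem_iUnion.trans (exists_congr fun π => ?_)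
  simp only [Set.mem_iInter]
  exact forall₂_congr fun y hy => (and_iff_left hy).symm

theorem obstructionVariety_eq_setOf_forall_exists_mem_incidence (A : PolyMatrix l k n) (r : ℕ) :
    obstructionVariety A r = {z | ∀ σ : Gr r n, ∃ y, (y, z, σ) ∈ incidence A r} := by
  ext z
  refine Set.mem_iInter.trans (forall_congr' fun σ => ?_)
  simp only [Set.mem_iUnion, exists_prop]
  exact exists_congr fun y => and_comm

end WaveAndObstruction

section Incidence

variable {l k n d m : ℕ} {A : PolyMatrix l k n}

theorem isWeightedHomogeneous_rename {R M σ τ : Type*} [CommSemiring R] [AddCommMonoid M]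
    {p : MvPolynomial σ R} (hp : p.IsHomogeneous d) {f : σ → τ} {w : τ → M} {μ : M}
    (hf : ∀ s, w (f s) = μ) : (rename f p).IsWeightedHomogeneous w (d • μ) := by
  rw [p.as_sum, map_sum]
  refine IsWeightedHomogeneous.sum _ _ _ fun a ha => ?_
  rw [rename_monomial]
  refine isWeightedHomogeneous_monomial _ _ _ ?_
  rw [Finsupp.weight_apply, Finsupp.sum_mapDomain_index (by simp) (by simp [add_smul]),
    hp.degree_eq_sum_deg_support ha]
  simp only [hf, Finsupp.sum, Finset.sum_smul]

/-- The polynomials in `(y, z, p)` that express `A(y) z = 0`, one for each row of `A`. -/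
noncomputable def kernelEquation (A : PolyMatrix l k n) (m : ℕ) (i : Fin l) :
    MvPolynomial (Fin n ⊕ Fin k ⊕ (Fin m ↪o Fin n)) ℂ :=
  ∑ j, rename Sum.inl (A i j) * X (Sum.inr (Sum.inl j))

/-- The bilinear polynomials in `y` and the Plücker coordinates `p` of `π` that express `y ∈ π`:
the expansions along the first row of the `(m + 1) × (m + 1)` minors of the matrix whose rows are
`y` and a basis of `π`. -/
noncomputable def membershipEquation (k : ℕ) (J : Fin (m + 1) ↪o Fin n) :
    MvPolynomial (Fin n ⊕ Fin k ⊕ (Fin m ↪o Fin n)) ℂ :=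
  ∑ s : Fin (m + 1), C ((-1) ^ (s : ℕ)) *
    (X (Sum.inl (J s)) * X (Sum.inr (Sum.inr ((Fin.succAboveOrderEmb s).trans J))))

theorem isWeightedHomogeneous_kernelEquation (hA : ∀ i j, (A i j).IsHomogeneous d) (i : Fin l) :
    (kernelEquation A m i).IsWeightedHomogeneous triWeight (d, 1, 0) := by
  refine IsWeightedHomogeneous.sum _ _ _ fun j _ => ?_
  have hrename : IsWeightedHomogeneous (triWeight (α := Fin n) (β := Fin k) (γ := Fin m ↪o Fin n))
      (rename Sum.inl (A i j)) (d • (1, 0, 0)) :=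
    isWeightedHomogeneous_rename (hA i j) fun _ => rfl
  simpa [triWeight] using hrename.mul (isWeightedHomogeneous_X ℂ triWeight (Sum.inr (Sum.inl j)))

theorem isWeightedHomogeneous_membershipEquation (J : Fin (m + 1) ↪o Fin n) :
    (membershipEquation k J).IsWeightedHomogeneous triWeight (1, 0, 1) :=
  IsWeightedHomogeneous.sum _ _ _ fun _ _ =>
    ((isWeightedHomogeneous_X ℂ triWeight _).mul (isWeightedHomogeneous_X ℂ triWeight _)).C_mul _

theorem eval_kernelEquation (i : Fin l) (v : Fin n → ℂ) (w : Fin k → ℂ)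
    (p : (Fin m ↪o Fin n) → ℂ) :
    eval (Sum.elim v (Sum.elim w p)) (kernelEquation A m i) = (evalAt A v).mulVec w i := by
  simp [kernelEquation, Matrix.mulVec, dotProduct, evalAt, eval_rename]

theorem eval_membershipEquation (J : Fin (m + 1) ↪o Fin n) (v : Fin n → ℂ) (w : Fin k → ℂ)
    (S : Matrix (Fin m) (Fin n) ℂ) :
    eval (Sum.elim v (Sum.elim w fun I : Fin m ↪o Fin n => (S.submatrix id I).det))
      (membershipEquation k J) =
      ((Matrix.of (Fin.cons v S.row : Fin (m + 1) → Fin n → ℂ)).submatrix id J).det := by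
  rw [Matrix.det_succ_row_zero]
  simp only [membershipEquation, map_sum, map_mul, eval_C, eval_X, Sum.elim_inl, Sum.elim_inr]
  exact Finset.sum_congr rfl fun s _ => (mul_assoc _ _ _).symm

theorem isTriprojectiveVariety_incidence (hA : ∀ i j, (A i j).IsHomogeneous d) (m : ℕ) :
    IsTriprojectiveVariety (incidence A m) := by
  refine ⟨Set.range (kernelEquation A m) ∪ Set.range (membershipEquation k),
    (Set.finite_range _).union (Set.finite_range _), ?_, ?_⟩
  · rintro _ (⟨i, rfl⟩ | ⟨J, rfl⟩)
    · exact ⟨_, isWeightedHomogeneous_kernelEquation hA i⟩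
    · exact ⟨_, isWeightedHomogeneous_membershipEquation J⟩
  · rintro v hv w hw π p ⟨S, hS, hp⟩
    obtain rfl : p = fun I : Fin m ↪o Fin n => (S.submatrix id I).det := funext hp
    have hspan : Submodule.span ℂ (Set.range S.row) = π.1 := hS
    have hrow : LinearIndependent ℂ S.row := by
      rw [linearIndependent_iff_card_eq_finrank_span, Set.finrank, hspan, π.2, Fintype.card_fin]
    have hkernel : Projectivization.mk ℂ w hw ∈ kerAt A (Projectivization.mk ℂ v hv) ↔
        ∀ i, (evalAt A v).mulVec w i = 0 :=
      (mk_mem_kerAt_mk A hA v hv w hw).trans _root_.funext_iff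
    have hmem : Projectivization.mk ℂ v hv ∈ points π.1 ↔ ∀ J : Fin (m + 1) ↪o Fin n,
        ((Matrix.of (Fin.cons v S.row : Fin (m + 1) → Fin n → ℂ)).submatrix id J).det = 0 := by
      rw [mk_mem_points, ← hspan, mem_span_row_iff_forall_det_cons_eq_zero hrow]
    simp only [Set.mem_union, or_imp, forall_and, Set.forall_mem_range, eval_kernelEquation,
      eval_membershipEquation, ← hkernel, ← hmem]
    rfl

end Incidence

end WaveVar

theorem mainTheorem6 (n k l d : ℕ) (A : WaveVar.PolyMatrix l k n)
    (hA : ∀ i j, (A i j).IsHomogeneous d) :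
    (∀ r : ℕ, r < n → WaveVar.IsProjectiveVariety (WaveVar.waveVariety A r)) ∧
    (∀ r : ℕ, 1 ≤ r → r ≤ n →
      WaveVar.IsProjectiveVariety (WaveVar.obstructionVariety A r)) ∧
    (∀ m : ℕ, 1 ≤ m → m ≤ n → WaveVar.IsTriprojectiveVariety (WaveVar.incidence A m)) ∧
    (∀ r : ℕ, r < n → WaveVar.waveVariety A r =
      {z | ∃ π : WaveVar.Gr (n - r) n, ∀ y ∈ WaveVar.points π.1,
        (y, z, π) ∈ WaveVar.incidence A (n - r)}) ∧
    (∀ r : ℕ, 1 ≤ r → r ≤ n → WaveVar.obstructionVariety A r =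
      {z | ∀ σ : WaveVar.Gr r n, ∃ y : WaveVar.ProjPt n,
        (y, z, σ) ∈ WaveVar.incidence A r}) :=
  ⟨fun _ hr => WaveVar.isProjectiveVariety_waveVariety hA hr,
    fun r _ _ => WaveVar.isProjectiveVariety_obstructionVariety hA r,
    fun m _ _ => WaveVar.isTriprojectiveVariety_incidence hA m,
    fun r _ => WaveVar.waveVariety_eq_setOf_exists_forall_mem_incidence A r,
    fun r _ _ => WaveVar.obstructionVariety_eq_setOf_forall_exists_mem_incidence A r⟩
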